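/- Let $n\in\{2,3\}$, $\Omega=(\mathbb R/\mathbb Z)^n$, $T>0$, $k,\alpha\in\mathbb R$, and let $\gamma\in C^2((0,\infty))$ be monotonically decreasing on $(0,\infty)$ and bounded above on $[0,\infty)$. Put $W(s)=\tfrac12 s^2(1-s)^2$ and $G(s)=\tfrac12 s^2-\tfrac13 s^3$. For every $\varepsilon>0$ let $(\varphi^\varepsilon,u^\varepsilon)$ be a classical solution (of class $C^{2,1}(\Omega\times(0,T))\cap C(\Omega\times[0,T))$) of $$\varepsilon^2\varphi^\varepsilon_t=\varepsilon^2\Delta\varphi^\varepsilon-\tfrac12W'(\varphi^\varepsilon)-\varepsilon G'(\varphi^\varepsilon)\bigl(-\gamma(u^\varepsilon)+\tilde S[\varphi^\varepsilon](t)\bigr),\qquad u^\varepsilon_t=\Delta u^\varepsilon-ku^\varepsilon+\varphi^\varepsilon\quad\text{in }\Omega\times(0,T),$$ $$\varphi^\varepsilon|_{t=0}=\varphi^\varepsilon_0,\quad u^\varepsilon|_{t=0}=u^\varepsilon_0,\qquad \tilde S[\varphi^\varepsilon](t)=\alpha\Bigl(\int_\Omega G(\varphi^\varepsilon(x,t))\,dx-\int_\Omega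 G(\varphi_0^\varepsilon)\,dx\Bigr),$$ where $0<\varphi_0^\varepsilon<1$, $u_0^\varepsilon\ge0$, $\varphi^\varepsilon_0,u^\varepsilon_0\in H^1(\Omega)$, $\sup_{\varepsilon>0}\|u_0^\varepsilon\|_{H^1(\Omega)}<\infty$ and $\sup_{\varepsilon>0}\int_\Omega\bigl(\tfrac{\varepsilon|\nabla\varphi_0^\varepsilon|^2}{2}+\tfrac{W(\varphi_0^\varepsilon)}{2\varepsilon}\bigr)dx<\infty$. Let $\varepsilon_j>0$, $\varepsilon_j\to0$, and let $u$ and $\varphi$ be limits of $u^{\varepsilon_j}$ and $\varphi^{\varepsilon_j}$ in the following sense: - $u\in H^1(\Omega\times(0,T))$, and $u^{\varepsilon_j}\to u$ weakly in $H^1(\Omega\times(0,T))$ and strongly in $L^2(\Omega\times(0,T))$; - $\varphi\in BV(\Omega\times[0,T))\cap C^{1/2}([0,T);L^1(\Omega))$, $\varphi^{\varepsilon_j}\to\varphi$ a.e. in $\Omega\times(0,T)$ and in $L^1(\Omega\times(0,T))$, and $6G(\varphi^{\varepsilon_j}(\cdot,t))\to\varphi(\cdot,t)$ in $L^1(\Omega)$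 for all $t\in[0,T)$. Suppose that, along some subsequence of $(\varepsilon_j)$, the initial data $u_0^{\varepsilon_j}$ converge weakly in $L^2(\Omega)$ to a function $u_0$. Then $u$ is a weak solution of $$u_t=\Delta u-ku+\varphi\ \text{ in }\Omega\times(0,T),\qquad u|_{t=0}=u_0\ \text{ in }\Omega,$$ that is, $u\in H^1(\Omega\times(0,T))$; for all $\eta\in C_c^\infty(\Omega\times(0,T))$ $$\int_0^T\!\!\int_\Omega u_t\,\eta\,dx\,dt=\int_0^T\!\!\int_\Omega\bigl(-\nabla u\cdot\nabla\eta-ku\eta+\varphi\eta\bigr)\,dx\,dt;$$ and $u$ has a representative in $C([0,T);L^2(\Omega))$ whose value at $t=0$ is $u_0$. -/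

import Mathlib

open MeasureTheory Filter Topology Set
open scoped ContDiff

noncomputable section

namespace PhaseField

/-- The flat torus `(ℝ/ℤ)ⁿ`, with its Haar (Lebesgue) measure of total mass `1`. -/
abbrev Torus (n : ℕ) : Type := UnitAddTorus (Fin n)

/-- The covering map `ℝⁿ → (ℝ/ℤ)ⁿ`. -/
def torusMk {n : ℕ} (y : Fin n → ℝ) : Torus n := fun i => (y i : UnitAddCircle)

/-! ### Classical derivatives on the torus and on the space-time cylinder -/

/-- `∂f/∂xᵢ` for a function on the torus: the derivative at `s = 0` of `s ↦ f (x + s eᵢ)`. -/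
def torusPartial {n : ℕ} (i : Fin n) (f : Torus n → ℝ) (x : Torus n) : ℝ :=
  deriv (fun s : ℝ => f (x + Pi.single i (s : UnitAddCircle))) 0

/-- `∂f/∂xᵢ` for a function of `(x, t)`. -/
def dx {n : ℕ} (i : Fin n) (f : Torus n × ℝ → ℝ) (p : Torus n × ℝ) : ℝ :=
  torusPartial i (fun y => f (y, p.2)) p.1

/-- `∂f/∂t` for a function of `(x, t)`. -/
def dt {n : ℕ} (f : Torus n × ℝ → ℝ) (p : Torus n × ℝ) : ℝ :=
  deriv (fun s : ℝ => f (p.1, s)) p.2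

/-- The Laplacian in the space variable. -/
def laplacian {n : ℕ} (f : Torus n × ℝ → ℝ) (p : Torus n × ℝ) : ℝ :=
  ∑ i, dx i (dx i f) p

/-- `f ∈ C^{2,1}(Ω × (0,T)) ∩ C(Ω × [0,T))`. -/
structure IsClassical {n : ℕ} (T : ℝ) (f : Torus n × ℝ → ℝ) : Prop where
  continuousOn : ContinuousOn f (univ ×ˢ Ico 0 T)
  contDiff_space : ∀ t ∈ Ioo 0 T, ContDiff ℝ 2 (fun y : Fin n → ℝ => f (torusMk y, t))
  differentiable_time : ∀ x : Torus n, ∀ t ∈ Ioo 0 T, DifferentiableAt ℝ (fun s => f (x, s)) t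
  continuousOn_dt : ContinuousOn (dt f) (univ ×ˢ Ioo 0 T)
  continuousOn_dx : ∀ i, ContinuousOn (dx i f) (univ ×ˢ Ioo 0 T)
  continuousOn_dxx : ∀ i j, ContinuousOn (dx j (dx i f)) (univ ×ˢ Ioo 0 T)

/-! ### The phase-field system -/

/-- The double-well potential `W(s) = s² (1 - s)² / 2`. -/
def W (s : ℝ) : ℝ := s ^ 2 * (1 - s) ^ 2 / 2

/-- `G(s) = s² / 2 - s³ / 3`. -/
def G (s : ℝ) : ℝ := s ^ 2 / 2 - s ^ 3 / 3

/-- The nonlocal term `α (∫ G(φ(x,t)) dx - ∫ G(φ₀(x)) dx)`. -/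
def nonlocalTerm {n : ℕ} (α : ℝ) (φ : Torus n × ℝ → ℝ) (φ₀ : Torus n → ℝ) (t : ℝ) : ℝ :=
  α * ((∫ x, G (φ (x, t))) - ∫ x, G (φ₀ x))

/-- `(φ, u)` is a classical solution on `Ω × [0,T)` of
`ε² φ_t = ε² Δφ - W'(φ)/2 - ε G'(φ) (-γ(u) + S)`, `u_t = Δu - k u + φ`,
with initial data `φ₀`, `u₀`, where `S` is the nonlocal term. -/
structure IsClassicalSolution {n : ℕ} (T k α : ℝ) (γ : ℝ → ℝ) (ε : ℝ)
    (φ₀ u₀ : Torus n → ℝ) (φ u : Torus n × ℝ → ℝ) : Prop where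
  regular_φ : IsClassical T φ
  regular_u : IsClassical T u
  eq_φ : ∀ x : Torus n, ∀ t ∈ Ioo 0 T,
    ε ^ 2 * dt φ (x, t) = ε ^ 2 * laplacian φ (x, t) - deriv W (φ (x, t)) / 2
      - ε * deriv G (φ (x, t)) * (-γ (u (x, t)) + nonlocalTerm α φ φ₀ t)
  eq_u : ∀ x : Torus n, ∀ t ∈ Ioo 0 T,
    dt u (x, t) = laplacian u (x, t) - k * u (x, t) + φ (x, t)
  init_φ : ∀ x, φ (x, 0) = φ₀ x
  init_u : ∀ x, u (x, 0) = u₀ x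

/-! ### Sobolev spaces -/

/-- `g` is the weak gradient of `f ∈ H¹(Ω)` on the torus `Ω`. -/
structure IsH1Torus {n : ℕ} (f : Torus n → ℝ) (g : Fin n → Torus n → ℝ) : Prop where
  memLp : MemLp f 2
  memLp_grad : ∀ i, MemLp (g i) 2
  weak_grad : ∀ ψ : Torus n → ℝ, ContDiff ℝ ∞ (fun y : Fin n → ℝ => ψ (torusMk y)) →
    ∀ i, ∫ x, f x * torusPartial i ψ x = -∫ x, g i x * ψ x

/-- Lebesgue measure on the cylinder `Ω × (0,T)`. -/
def cyl (n : ℕ) (T : ℝ) : Measure (Torus n × ℝ) :=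
  (volume : Measure (Torus n)).prod (volume.restrict (Ioo 0 T))

/-- Test functions: `η ∈ C_c^∞(Ω × (0,T))`. -/
structure IsTest {n : ℕ} (T : ℝ) (η : Torus n × ℝ → ℝ) : Prop where
  smooth : ContDiff ℝ ∞ (fun q : (Fin n → ℝ) × ℝ => η (torusMk q.1, q.2))
  compact : HasCompactSupport η
  support : tsupport η ⊆ univ ×ˢ Ioo 0 T

/-- `f ∈ H¹(Ω × (0,T))`, with weak space gradient `g` and weak time derivative `h`. -/
structure IsH1Cyl {n : ℕ} (T : ℝ) (f : Torus n × ℝ → ℝ) (g : Fin n → Torus n × ℝ → ℝ)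
    (h : Torus n × ℝ → ℝ) : Prop where
  memLp : MemLp f 2 (cyl n T)
  memLp_grad : ∀ i, MemLp (g i) 2 (cyl n T)
  memLp_time : MemLp h 2 (cyl n T)
  weak_grad : ∀ η, IsTest T η → ∀ i,
    ∫ p, f p * dx i η p ∂(cyl n T) = -∫ p, g i p * η p ∂(cyl n T)
  weak_time : ∀ η, IsTest T η →
    ∫ p, f p * dt η p ∂(cyl n T) = -∫ p, h p * η p ∂(cyl n T)

/-- Weak convergence in `L²(μ)`. -/
def WeakL2Tendsto {X : Type*} [MeasurableSpace X] (μ : Measure X) (v : ℕ → X → ℝ)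
    (w : X → ℝ) : Prop :=
  (∀ j, MemLp (v j) 2 μ) ∧ MemLp w 2 μ ∧
    ∀ z, MemLp z 2 μ → Tendsto (fun j => ∫ p, v j p * z p ∂μ) atTop (𝓝 (∫ p, w p * z p ∂μ))

/-- Weak convergence in `H¹(Ω × (0,T))`: all functions lie in `H¹`, and the functions together
with all their first-order weak derivatives converge weakly in `L²`. -/
def WeakH1Tendsto {n : ℕ} (T : ℝ) (v : ℕ → Torus n × ℝ → ℝ) (w : Torus n × ℝ → ℝ) : Prop :=
  ∃ (gv : ℕ → Fin n → Torus n × ℝ → ℝ) (hv : ℕ → Torus n × ℝ → ℝ)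
    (gw : Fin n → Torus n × ℝ → ℝ) (hw : Torus n × ℝ → ℝ),
    (∀ j, IsH1Cyl T (v j) (gv j) (hv j)) ∧ IsH1Cyl T w gw hw ∧
    WeakL2Tendsto (cyl n T) v w ∧
    (∀ i, WeakL2Tendsto (cyl n T) (fun j => gv j i) (gw i)) ∧
    WeakL2Tendsto (cyl n T) hv hw

/-- `f ∈ BV(Ω × (0,T))`: integrable and of finite total variation. -/
def IsBV {n : ℕ} (T : ℝ) (f : Torus n × ℝ → ℝ) : Prop :=
  Integrable f (cyl n T) ∧
    ∃ C : ℝ, ∀ (X : Fin n → Torus n × ℝ → ℝ) (Y : Torus n × ℝ → ℝ),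
      (∀ i, IsTest T (X i)) → IsTest T Y → (∀ p, ∑ i, X i p ^ 2 + Y p ^ 2 ≤ 1) →
      ∫ p, f p * (∑ i, dx i (X i) p + dt Y p) ∂(cyl n T) ≤ C

/-- `f ∈ C^{1/2}([0,T); L¹(Ω))`. -/
def IsHolderHalfL1 {n : ℕ} (T : ℝ) (f : Torus n × ℝ → ℝ) : Prop :=
  (∀ t ∈ Ico 0 T, Integrable (fun x => f (x, t))) ∧
    ∃ C : ℝ, ∀ s ∈ Ico 0 T, ∀ t ∈ Ico 0 T, ∫ x, |f (x, t) - f (x, s)| ≤ C * √|t - s|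

/-! ### Limit pairs -/

/-- `v j → w` weakly in `H¹(Ω × (0,T))` and strongly in `L²(Ω × (0,T))`, with `w ∈ H¹`. -/
structure IsLimitPairU {n : ℕ} (T : ℝ) (v : ℕ → Torus n × ℝ → ℝ) (w : Torus n × ℝ → ℝ) :
    Prop where
  weakH1 : WeakH1Tendsto T v w
  strongL2 : Tendsto (fun j => eLpNorm (fun p => v j p - w p) 2 (cyl n T)) atTop (𝓝 0)

/-- `v j → w` almost everywhere and in `L¹(Ω × (0,T))`, and `6 G(v j (·,t)) → w (·,t)` in `L¹(Ω)`
for every `t`, where `w ∈ BV ∩ C^{1/2}([0,T); L¹(Ω))`. -/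
structure IsLimitPairφ {n : ℕ} (T : ℝ) (v : ℕ → Torus n × ℝ → ℝ) (w : Torus n × ℝ → ℝ) :
    Prop where
  bv : IsBV T w
  holder : IsHolderHalfL1 T w
  ae_tendsto : ∀ᵐ p ∂(cyl n T), Tendsto (fun j => v j p) atTop (𝓝 (w p))
  strongL1 : Tendsto (fun j => eLpNorm (fun p => v j p - w p) 1 (cyl n T)) atTop (𝓝 0)
  slices : ∀ t ∈ Ico 0 T,
    Tendsto (fun j => eLpNorm (fun x : Torus n => 6 * G (v j (x, t)) - w (x, t)) 1 volume)
      atTop (𝓝 0)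

/-! ### Weak solutions of the limit equation -/

/-- `u|_{t=0} = u₀`: `u` has a representative in `C([0,T); L²(Ω))` whose value at `0` is `u₀`. -/
def HasInitialValue {n : ℕ} (T : ℝ) (u : Torus n × ℝ → ℝ) (u₀ : Torus n → ℝ) : Prop :=
  ∃ v : Torus n × ℝ → ℝ, v =ᵐ[cyl n T] u ∧
    (∀ t ∈ Ico 0 T, MemLp (fun x => v (x, t)) 2) ∧
    (∀ s ∈ Ico 0 T, Tendsto (fun t => eLpNorm (fun x : Torus n => v (x, t) - v (x, s)) 2 volume)
      (𝓝[Ico 0 T] s) (𝓝 0)) ∧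
    (fun x => v (x, 0)) =ᵐ[volume] u₀

/-- `u ∈ H¹(Ω × (0,T))` is a weak solution of `u_t = Δu - k u + φ`, `u|_{t=0} = u₀`. -/
def IsWeakSolution {n : ℕ} (T k : ℝ) (φ : Torus n × ℝ → ℝ) (u₀ : Torus n → ℝ)
    (u : Torus n × ℝ → ℝ) : Prop :=
  (∃ (g : Fin n → Torus n × ℝ → ℝ) (h : Torus n × ℝ → ℝ), IsH1Cyl T u g h ∧
    ∀ η, IsTest T η →
      ∫ p, h p * η p ∂(cyl n T) =
        ∫ p, (-(∑ i, g i p * dx i η p) - k * u p * η p + φ p * η p) ∂(cyl n T)) ∧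
  HasInitialValue T u u₀

end PhaseField

end

open PhaseField

namespace PhaseField

/-! ### The covering map of the torus -/

/-! The diffusion equation is linear in `(u, φ)`. Moving every derivative onto a test function gives
`∫ u (η_t + Δη - k η) = -∫ φ η` for each classical solution (`IsClassicalSolution.very_weak`). This
form passes to the limit with only weak `L²` convergence of `u` and `L¹` convergence of `φ`. The
time derivative and one space derivative are then moved back onto the limit, which lies in `H¹`
(`weak_equation_of_limit`).

For the initial value, let `h` be the weak time derivative of the limit. The representative is
`u₀(x) + ∫₀ᵗ h(x,s) ds`. By Cauchy–Schwarz in time it is 1/2-Hölder with values in `L²`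
(`eLpNorm_intervalIntegral_le`).

It is identified with `u` through moments against smooth `a`. Moments of the approximations obey the
fundamental theorem of calculus from time `0` (`IsClassical.moment_eq`), so weak convergence of the
initial data and of the time derivatives gives their limit at every time. Strong `L²` convergence
gives `L¹(0,T)` convergence of the same moments to those of `u`. The two limits agree for almost
every time. Letting `a` run over the countably many real and imaginary parts of characters, Fourier
uniqueness finishes the identification (`hasInitialValue_of_limit`). -/

theorem isOpenQuotientMap_torusMk (n : ℕ) : IsOpenQuotientMap (torusMk (n := n)) :=
  IsOpenQuotientMap.piMap fun _ => QuotientAddGroup.isOpenQuotientMap_mk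

theorem isOpenQuotientMap_torusMk_prod (n : ℕ) :
    IsOpenQuotientMap (fun q : (Fin n → ℝ) × ℝ => (torusMk q.1, q.2)) :=
  (isOpenQuotientMap_torusMk n).prodMap IsOpenQuotientMap.id

theorem torusMk_add_smul_single {n : ℕ} (y : Fin n → ℝ) (i : Fin n) (s : ℝ) :
    torusMk (y + s • Pi.single i (1 : ℝ)) = torusMk y + Pi.single i (s : UnitAddCircle) := by
  funext j
  by_cases h : j = i
  · subst h; simp [torusMk]
  · simp [torusMk, h]

instance isProbabilityMeasure_unitAddCircle :
    IsProbabilityMeasure (volume : Measure UnitAddCircle) :=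
  ⟨by simp⟩

instance isAddLeftInvariant_torus_prod (n : ℕ) :
    (volume : Measure (Torus n × ℝ)).IsAddLeftInvariant := by
  rw [Measure.volume_eq_prod]; exact Measure.prod.instIsAddLeftInvariant

/-! ### Directional derivatives on `Torus n × ℝ` -/

/-- The translation direction `s ↦ (s eᵢ, 0)`. -/
def spaceDir {n : ℕ} (i : Fin n) : ℝ →+ Torus n × ℝ where
  toFun s := (Pi.single i (s : UnitAddCircle), 0)
  map_zero' := by simp
  map_add' s t := by
    ext j
    · by_cases h : j = i
      · subst h; simp
      · simp [h]
    · simp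

/-- The translation direction `s ↦ (0, s)`. -/
def timeDir (n : ℕ) : ℝ →+ Torus n × ℝ := AddMonoidHom.inr (Torus n) ℝ

theorem continuous_spaceDir {n : ℕ} (i : Fin n) : Continuous (spaceDir i) := by
  have : Continuous fun s : ℝ => (s : UnitAddCircle) := AddCircle.continuous_mk' _
  exact ((continuous_single (A := fun _ : Fin n => UnitAddCircle) i).comp this).prodMk
    continuous_const

theorem continuous_timeDir (n : ℕ) : Continuous (timeDir n) :=
  continuous_const.prodMk continuous_id

/-- `f' p` is the derivative of `f` at `p` along the one-parameter subgroup `c`. -/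
def HasDirDerivAt {H : Type*} [AddGroup H] (c : ℝ →+ H) (f : H → ℝ) (f' : ℝ) (p : H) : Prop :=
  HasDerivAt (fun s => f (p + c s)) f' 0

/-- As `c` is a homomorphism, a derivative at parameter `0` can be shifted to any point of the
orbit, so calculus on `ℝ` applies along it. -/
theorem HasDirDerivAt.hasDerivAt {H : Type*} [AddGroup H] {c : ℝ →+ H} {f : H → ℝ} {f' s : ℝ}
    {p : H}
    (h : HasDirDerivAt c f f' (p + c s)) : HasDerivAt (fun r => f (p + c r)) f' s := by
  have h1 : HasDerivAt (fun r => f (p + c s + c r)) f' (s - s) := by simpa [HasDirDerivAt] using h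
  have h2 := h1.comp_sub_const s s
  refine h2.congr_of_eventuallyEq (Eventually.of_forall fun r => ?_)
  change _ = f (p + c s + c (r - s))
  rw [add_assoc, ← map_add, add_sub_cancel]

theorem HasDirDerivAt.mul {H : Type*} [AddGroup H] {c : ℝ →+ H} {f g : H → ℝ} {f' g' : ℝ} {p : H}
    (hf : HasDirDerivAt c f f' p) (hg : HasDirDerivAt c g g' p) :
    HasDirDerivAt c (fun q => f q * g q) (f' * g p + f p * g') p := by
  unfold HasDirDerivAt
  simpa only [map_zero, add_zero] using HasDerivAt.fun_mul hf hg

/-! ### Integration by parts along one-parameter subgroups -/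

/-- The integral of a directional derivative vanishes. -/
theorem integral_dirDeriv_eq_zero {n : ℕ} {c : ℝ →+ Torus n × ℝ} (hc : Continuous c)
    {F F' : Torus n × ℝ → ℝ} (hF : Integrable F) (hF' : Continuous F') (hF'i : Integrable F')
    (h : ∀ p, HasDirDerivAt c F (F' p) p) : ∫ p, F' p = 0 := by
  -- The increment of `F` along the orbit has zero integral by translation invariance. By Fubini and
  -- invariance again, that integral is also the integral of `F'`.
  have h1 : ∀ p, ∫ s in (0 : ℝ)..1, F' (p + c s) = F (p + c 1) - F p := by
    intro p
    rw [intervalIntegral.integral_eq_sub_of_hasDerivAt (f := fun s => F (p + c s))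
      (fun s _ => (h (p + c s)).hasDerivAt) ((by fun_prop : Continuous _).intervalIntegrable _ _)]
    simp
  have h2 : ∫ p, (∫ s in (0 : ℝ)..1, F' (p + c s)) = 0 := by
    simp_rw [h1]
    rw [integral_sub (hF.comp_add_right (c 1)) hF, integral_add_right_eq_self F (c 1), sub_self]
  have hint : Integrable (fun z : (Torus n × ℝ) × ℝ => F' (z.1 + c z.2))
      ((volume : Measure (Torus n × ℝ)).prod (volume.restrict (Ioc (0 : ℝ) 1))) := by
    rw [integrable_prod_iff' (by fun_prop : Continuous _).aestronglyMeasurable]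
    refine ⟨ae_of_all _ fun s => hF'i.comp_add_right (c s), ?_⟩
    have : ∀ s, ∫ p, ‖F' (p + c s)‖ = ∫ p, ‖F' p‖ := fun s =>
      integral_add_right_eq_self (fun p => ‖F' p‖) (c s)
    simp only [this]
    exact integrable_const _
  simp_rw [intervalIntegral.integral_of_le zero_le_one] at h2
  rw [integral_integral_swap hint] at h2
  simpa [integral_add_right_eq_self F'] using h2

theorem HasDirDerivAt.eq_zero_of_notMem_tsupport {n : ℕ} {c : ℝ →+ Torus n × ℝ} (hc : Continuous c)
    {η : Torus n × ℝ → ℝ} {a : ℝ} {p : Torus n × ℝ} (h : HasDirDerivAt c η a p)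
    (hp : p ∉ tsupport η) : a = 0 := by
  have h1 : ∀ᶠ q in 𝓝 p, η q = 0 := by
    filter_upwards [(isClosed_tsupport η).isOpen_compl.mem_nhds hp] with q hq
    exact image_eq_zero_of_notMem_tsupport hq
  have h2 : Tendsto (fun s : ℝ => p + c s) (𝓝 0) (𝓝 p) :=
    (by fun_prop : Continuous fun s => p + c s).tendsto' 0 p (by simp)
  exact HasDerivAt.unique h
    ((hasDerivAt_const (0 : ℝ) (0 : ℝ)).congr_of_eventuallyEq (h2.eventually h1))

/-- Integration by parts on an open subset of `Torus n × ℝ`. -/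
theorem integral_dirDeriv_mul {n : ℕ} {c : ℝ →+ Torus n × ℝ} (hc : Continuous c)
    {U : Set (Torus n × ℝ)} (hU : IsOpen U)
    {f f' η η' : Torus n × ℝ → ℝ} (hf : ContinuousOn f U) (hf' : ContinuousOn f' U)
    (hd : ∀ p ∈ U, HasDirDerivAt c f (f' p) p) (hη : Continuous η) (hη' : Continuous η')
    (hηd : ∀ p, HasDirDerivAt c η (η' p) p) (hK : HasCompactSupport η) (hKU : tsupport η ⊆ U) :
    ∫ p, f' p * η p = -∫ p, f p * η' p := by
  have hout : ∀ p ∉ tsupport η, ∀ᶠ q in 𝓝 p, η q = 0 := fun p hp => by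
    filter_upwards [(isClosed_tsupport η).isOpen_compl.mem_nhds hp] with q hq
    exact image_eq_zero_of_notMem_tsupport hq
  have hev : ∀ p, Tendsto (fun s : ℝ => p + c s) (𝓝 0) (𝓝 p) := fun p =>
    (by fun_prop : Continuous fun s => p + c s).tendsto' 0 p (by simp)
  have hz : ∀ p ∉ tsupport η, η' p = 0 := fun p hp =>
    (hηd p).eq_zero_of_notMem_tsupport hc hp
  have hz' : tsupport η' ⊆ tsupport η := closure_minimal
    (fun p hp => by_contra fun h => hp (hz p h)) (isClosed_tsupport η)
  have hK' : HasCompactSupport η' := hK.mono' (subset_tsupport _ |>.trans hz')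
  -- Nothing is known about `f` outside `U`, but its products with functions supported in `U` are
  -- globally continuous.
  have cont : ∀ {a b : Torus n × ℝ → ℝ}, ContinuousOn a U → Continuous b → tsupport b ⊆ U →
      Continuous fun p => a p * b p := by
    intro a b ha hb hab
    exact continuous_of_tsupport fun p hp => by
      have := hab (tsupport_mul_subset_right hp)
      exact (ha.continuousAt (hU.mem_nhds this)).mul hb.continuousAt
  have c1 := cont hf' hη hKU
  have c2 := cont hf hη' (hz'.trans hKU)
  have c3 := cont hf hη hKU
  have i1 : Integrable fun p => f' p * η p := c1.integrable_of_hasCompactSupport hK.mul_left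
  have i2 : Integrable fun p => f p * η' p := c2.integrable_of_hasCompactSupport hK'.mul_left
  have i3 : Integrable fun p => f p * η p := c3.integrable_of_hasCompactSupport hK.mul_left
  have := integral_dirDeriv_eq_zero hc i3 (c1.add c2) (i1.add i2) (fun p => by
    by_cases hp : p ∈ tsupport η
    · exact (hd p (hKU hp)).mul (hηd p)
    · have hp' := (hev p).eventually (hout p hp)
      have : f' p * η p + f p * η' p = 0 := by
        rw [hz p hp, image_eq_zero_of_notMem_tsupport hp]; simp
      simp only [Pi.add_apply, this]
      refine (hasDerivAt_const (0 : ℝ) (0 : ℝ)).congr_of_eventuallyEq ?_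
      filter_upwards [hp'] with s hs
      simp [hs])
  rw [show (∫ p, ((fun p => f' p * η p) + fun p => f p * η' p) p) = _ from
    integral_add i1 i2] at this
  linarith

/-! ### Fourier uniqueness on the torus -/

/-- An `L²` function on the torus is zero if all its Fourier coefficients vanish. -/
theorem ae_eq_zero_of_integral_mFourier {n : ℕ} {w : Torus n → ℝ} (hw : MemLp w 2)
    (h : ∀ k : Fin n → ℤ, ∫ x, UnitAddTorus.mFourier k x * (w x : ℂ) = 0) :
    w =ᵐ[volume] 0 := by
  have hvol : (volume : Measure (Torus n)) = Measure.pi (fun _ => AddCircle.haarAddCircle) := by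
    rw [volume_pi]
    congr 1
    funext _
    rw [AddCircle.volume_eq_smul_haarAddCircle]
    simp
  have hc := hw.ofReal (K := ℂ)
  rw [hvol] at h hc ⊢
  have h0 : hc.toLp = 0 := by
    apply (UnitAddTorus.mFourierBasis (d := Fin n)).repr.injective
    ext k
    refine (UnitAddTorus.mFourierBasis_repr _ _).trans ?_
    rw [map_zero]
    -- The Fourier coefficient at `k` pairs with the conjugate character, which is the one of index
    -- `-k`.
    refine Eq.trans ?_ (h (-k))
    unfold UnitAddTorus.mFourierCoeff
    refine integral_congr_ae ?_
    filter_upwards [hc.coeFn_toLp] with x hx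
    rw [hx]; simp
  have h1 := hc.coeFn_toLp
  rw [h0] at h1
  filter_upwards [h1, Lp.coeFn_zero ℂ 2
    (Measure.pi (fun _ : Fin n => (AddCircle.haarAddCircle (T := 1))))] with x hx hx'
  have := hx.symm.trans hx'
  simpa using this

/-! ### Differentiation of classical functions and of test functions -/

theorem hasDirDerivAt_spaceDir_iff {n : ℕ} {i : Fin n} {f : Torus n × ℝ → ℝ} {f' : ℝ}
    {p : Torus n × ℝ} : HasDirDerivAt (spaceDir i) f f' p ↔
      HasDerivAt (fun s : ℝ => f (p.1 + Pi.single i (s : UnitAddCircle), p.2)) f' 0 := by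
  have : (fun s : ℝ => f (p + spaceDir i s)) =
      fun s : ℝ => f (p.1 + Pi.single i (s : UnitAddCircle), p.2) := by
    funext s
    congr 1
    ext1 <;> simp [spaceDir]
  rw [HasDirDerivAt, this]

theorem hasDirDerivAt_timeDir_iff {n : ℕ} {f : Torus n × ℝ → ℝ} {f' : ℝ}
    {p : Torus n × ℝ} : HasDirDerivAt (timeDir n) f f' p ↔
      HasDerivAt (fun s : ℝ => f (p.1, s)) f' p.2 := by
  have : (fun s : ℝ => f (p + timeDir n s)) = fun s : ℝ => f (p.1, p.2 + s) := by
    funext s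
    congr 1
    ext1 <;> simp [timeDir]
  rw [HasDirDerivAt, this]
  constructor
  · intro h
    have h1 : HasDerivAt (fun s : ℝ => f (p.1, p.2 + s)) f' (p.2 - p.2) := by simpa using h
    simpa using h1.comp_sub_const p.2 p.2
  · intro h
    have h1 : HasDerivAt (fun s : ℝ => f (p.1, s)) f' (p.2 + 0) := by simpa using h
    exact h1.comp_const_add p.2 0

theorem HasDirDerivAt.dx_eq {n : ℕ} {i : Fin n} {f : Torus n × ℝ → ℝ} {f' : ℝ}
    {p : Torus n × ℝ} (h : HasDirDerivAt (spaceDir i) f f' p) : dx i f p = f' :=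
  (hasDirDerivAt_spaceDir_iff.1 h).deriv

theorem HasDirDerivAt.dt_eq {n : ℕ} {f : Torus n × ℝ → ℝ} {f' : ℝ}
    {p : Torus n × ℝ} (h : HasDirDerivAt (timeDir n) f f' p) : dt f p = f' :=
  (hasDirDerivAt_timeDir_iff.1 h).deriv

theorem hasDirDerivAt_spaceDir_of_lift {n : ℕ} (i : Fin n) {f : Torus n × ℝ → ℝ} {y : Fin n → ℝ}
    {t : ℝ} (h : DifferentiableAt ℝ (fun y : Fin n → ℝ => f (torusMk y, t)) y) :
    HasDirDerivAt (spaceDir i) f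
      (fderiv ℝ (fun y : Fin n → ℝ => f (torusMk y, t)) y (Pi.single i 1)) (torusMk y, t) := by
  rw [hasDirDerivAt_spaceDir_iff]
  have := h.hasFDerivAt.hasLineDerivAt (Pi.single i (1 : ℝ))
  rw [HasLineDerivAt] at this
  simpa only [torusMk_add_smul_single] using this

theorem torusMk_surjective (n : ℕ) : Function.Surjective (torusMk (n := n)) :=
  (isOpenQuotientMap_torusMk n).surjective

section Classical

variable {n : ℕ} {T : ℝ} {f : Torus n × ℝ → ℝ}

theorem IsClassical.hasDirDerivAt_time (hf : IsClassical T f) {p : Torus n × ℝ}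
    (hp : p.2 ∈ Ioo 0 T) : HasDirDerivAt (timeDir n) f (dt f p) p :=
  hasDirDerivAt_timeDir_iff.2 (hf.differentiable_time p.1 p.2 hp).hasDerivAt

theorem IsClassical.hasDirDerivAt_space (hf : IsClassical T f) (i : Fin n) {p : Torus n × ℝ}
    (hp : p.2 ∈ Ioo 0 T) : HasDirDerivAt (spaceDir i) f (dx i f p) p := by
  obtain ⟨x, t⟩ := p
  obtain ⟨y, rfl⟩ := torusMk_surjective n x
  have := hasDirDerivAt_spaceDir_of_lift i
    ((hf.contDiff_space t hp).differentiable (by norm_num) y)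
  rwa [this.dx_eq]

/-- The lift of the first partial derivative is a component of the `fderiv` of a `C²` function,
hence `C¹`. -/
theorem IsClassical.hasDirDerivAt_dx (hf : IsClassical T f) (i : Fin n) {p : Torus n × ℝ}
    (hp : p.2 ∈ Ioo 0 T) : HasDirDerivAt (spaceDir i) (dx i f) (dx i (dx i f) p) p := by
  obtain ⟨x, t⟩ := p
  obtain ⟨y, rfl⟩ := torusMk_surjective n x
  have hC := hf.contDiff_space t hp
  have hlift : (fun y : Fin n → ℝ => dx i f (torusMk y, t)) = fun y =>
      fderiv ℝ (fun y : Fin n → ℝ => f (torusMk y, t)) y (Pi.single i 1) := by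
    funext y
    exact (hasDirDerivAt_spaceDir_of_lift i (hC.differentiable (by norm_num) y)).dx_eq
  have hd : Differentiable ℝ (fun y : Fin n → ℝ => dx i f (torusMk y, t)) := by
    rw [hlift]
    exact (hC.fderiv_right (m := 1) (by norm_num)).clm_apply contDiff_const
      |>.differentiable (by norm_num)
  have := hasDirDerivAt_spaceDir_of_lift i (hd y)
  rwa [this.dx_eq]

theorem IsClassical.continuousOn_Ioo (hf : IsClassical T f) :
    ContinuousOn f (univ ×ˢ Ioo 0 T) :=
  hf.continuousOn.mono (prod_mono_right Ioo_subset_Ico_self)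

end Classical

section Test

variable {n : ℕ} {T : ℝ} {η : Torus n × ℝ → ℝ}

theorem IsTest.continuous (h : IsTest T η) : Continuous η :=
  (isOpenQuotientMap_torusMk_prod n).isQuotientMap.continuous_iff.2 h.smooth.continuous

theorem IsTest.differentiable (h : IsTest T η) :
    Differentiable ℝ fun q : (Fin n → ℝ) × ℝ => η (torusMk q.1, q.2) :=
  h.smooth.differentiable (by simp)

theorem IsTest.hasDirDerivAt_space_lift (h : IsTest T η) (i : Fin n) (y : Fin n → ℝ) (t : ℝ) :
    HasDirDerivAt (spaceDir i) η
      (fderiv ℝ (fun q : (Fin n → ℝ) × ℝ => η (torusMk q.1, q.2)) (y, t) (Pi.single i 1, 0))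
      (torusMk y, t) := by
  rw [hasDirDerivAt_spaceDir_iff]
  have := (h.differentiable (y, t)).hasFDerivAt.hasLineDerivAt (Pi.single i (1 : ℝ), (0 : ℝ))
  rw [HasLineDerivAt] at this
  simpa [torusMk_add_smul_single] using this

theorem IsTest.hasDirDerivAt_time_lift (h : IsTest T η) (y : Fin n → ℝ) (t : ℝ) :
    HasDirDerivAt (timeDir n) η
      (fderiv ℝ (fun q : (Fin n → ℝ) × ℝ => η (torusMk q.1, q.2)) (y, t) (0, 1))
      (torusMk y, t) := by
  have := (h.differentiable (y, t)).hasFDerivAt.hasLineDerivAt ((0 : Fin n → ℝ), (1 : ℝ))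
  rw [HasLineDerivAt] at this
  rw [HasDirDerivAt]
  refine this.congr_of_eventuallyEq (Eventually.of_forall fun s => ?_)
  simp [timeDir]

theorem IsTest.hasDirDerivAt_space (h : IsTest T η) (i : Fin n) (p : Torus n × ℝ) :
    HasDirDerivAt (spaceDir i) η (dx i η p) p := by
  obtain ⟨x, t⟩ := p
  obtain ⟨y, rfl⟩ := torusMk_surjective n x
  have := h.hasDirDerivAt_space_lift i y t
  rwa [this.dx_eq]

theorem IsTest.hasDirDerivAt_time (h : IsTest T η) (p : Torus n × ℝ) :
    HasDirDerivAt (timeDir n) η (dt η p) p := by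
  obtain ⟨x, t⟩ := p
  obtain ⟨y, rfl⟩ := torusMk_surjective n x
  have := h.hasDirDerivAt_time_lift y t
  rwa [this.dt_eq]

theorem IsTest.of_support (h : IsTest T η) {ζ : Torus n × ℝ → ℝ}
    (hs : ContDiff ℝ ∞ (fun q : (Fin n → ℝ) × ℝ => ζ (torusMk q.1, q.2)))
    (h0 : ∀ p ∉ tsupport η, ζ p = 0) : IsTest T ζ := by
  have hz : Function.support ζ ⊆ tsupport η := fun p hp => by_contra fun hq => hp (h0 p hq)
  exact ⟨hs, h.compact.mono' hz, (closure_minimal hz (isClosed_tsupport η)).trans h.support⟩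

theorem IsTest.dx (h : IsTest T η) (i : Fin n) : IsTest T (dx i η) := by
  refine h.of_support ?_ fun p hp =>
    (h.hasDirDerivAt_space i p).eq_zero_of_notMem_tsupport (continuous_spaceDir i) hp
  have : (fun q : (Fin n → ℝ) × ℝ => PhaseField.dx i η (torusMk q.1, q.2)) = fun q =>
      fderiv ℝ (fun q : (Fin n → ℝ) × ℝ => η (torusMk q.1, q.2)) q (Pi.single i 1, 0) := by
    funext q
    exact (h.hasDirDerivAt_space_lift i q.1 q.2).dx_eq
  rw [this]
  exact (h.smooth.fderiv_right (m := ∞) (by simp)).clm_apply contDiff_const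

theorem IsTest.dt (h : IsTest T η) : IsTest T (dt η) := by
  refine h.of_support ?_ fun p hp =>
    (h.hasDirDerivAt_time p).eq_zero_of_notMem_tsupport (continuous_timeDir n) hp
  have : (fun q : (Fin n → ℝ) × ℝ => PhaseField.dt η (torusMk q.1, q.2)) = fun q =>
      fderiv ℝ (fun q : (Fin n → ℝ) × ℝ => η (torusMk q.1, q.2)) q (0, 1) := by
    funext q
    exact (h.hasDirDerivAt_time_lift q.1 q.2).dt_eq
  rw [this]
  exact (h.smooth.fderiv_right (m := ∞) (by simp)).clm_apply contDiff_const

theorem IsTest.eq_zero (h : IsTest T η) {p : Torus n × ℝ} (hp : p.2 ∉ Ioo 0 T) : η p = 0 :=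
  image_eq_zero_of_notMem_tsupport fun hq => hp (h.support hq).2

end Test

/-! ### Integration over the cylinder -/

theorem cyl_eq_restrict (n : ℕ) (T : ℝ) :
    cyl n T = (volume : Measure (Torus n × ℝ)).restrict (univ ×ˢ Ioo 0 T) := by
  rw [cyl, Measure.volume_eq_prod, ← Measure.prod_restrict, Measure.restrict_univ]

instance isFiniteMeasure_cyl (n : ℕ) (T : ℝ) : IsFiniteMeasure (cyl n T) := by
  rw [cyl]; infer_instance

theorem measurableSet_cylinder (n : ℕ) (T : ℝ) :
    MeasurableSet ((univ : Set (Torus n)) ×ˢ Ioo 0 T) :=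
  MeasurableSet.univ.prod measurableSet_Ioo

theorem isOpen_cylinder (n : ℕ) (T : ℝ) : IsOpen ((univ : Set (Torus n)) ×ˢ Ioo 0 T) :=
  isOpen_univ.prod isOpen_Ioo

theorem integral_cyl_eq {n : ℕ} {T : ℝ} {F : Torus n × ℝ → ℝ}
    (h : ∀ p : Torus n × ℝ, p.2 ∉ Ioo 0 T → F p = 0) : ∫ p, F p ∂(cyl n T) = ∫ p, F p := by
  rw [cyl_eq_restrict]
  exact setIntegral_eq_integral_of_forall_compl_eq_zero fun p hp => h p fun hq => hp ⟨mem_univ _, hq⟩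

theorem IsTest.memLp {n : ℕ} {T : ℝ} {η : Torus n × ℝ → ℝ} (h : IsTest T η) (p : ENNReal) :
    MemLp η p (cyl n T) :=
  h.continuous.memLp_of_hasCompactSupport h.compact

/-- `f` may be unbounded near `t = 0` and `t = T`. The compact support of `η` stays away from both
ends. -/
theorem integrable_mul_test {n : ℕ} {T : ℝ} {f η : Torus n × ℝ → ℝ}
    (hf : ContinuousOn f (univ ×ˢ Ioo 0 T)) (h : IsTest T η) :
    Integrable (fun p => f p * η p) (cyl n T) := by
  have hc : Continuous fun p => f p * η p := continuous_of_tsupport fun p hp =>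
    (hf.continuousAt ((isOpen_cylinder n T).mem_nhds
      (h.support (tsupport_mul_subset_right hp)))).mul h.continuous.continuousAt
  have := hc.integrable_of_hasCompactSupport (μ := cyl n T) h.compact.mul_left
  exact this

theorem integral_cyl_dirDeriv_mul {n : ℕ} {T : ℝ} {c : ℝ →+ Torus n × ℝ} (hc : Continuous c)
    {f f' η η' : Torus n × ℝ → ℝ} (hf : ContinuousOn f (univ ×ˢ Ioo 0 T))
    (hf' : ContinuousOn f' (univ ×ˢ Ioo 0 T))
    (hd : ∀ p : Torus n × ℝ, p.2 ∈ Ioo 0 T → HasDirDerivAt c f (f' p) p)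
    (hη : IsTest T η) (hη' : IsTest T η') (hηd : ∀ p, HasDirDerivAt c η (η' p) p) :
    ∫ p, f' p * η p ∂(cyl n T) = -∫ p, f p * η' p ∂(cyl n T) := by
  rw [integral_cyl_eq fun p hp => by rw [hη.eq_zero hp, mul_zero],
    integral_cyl_eq fun p hp => by rw [hη'.eq_zero hp, mul_zero]]
  exact integral_dirDeriv_mul hc (isOpen_cylinder n T) hf hf' (fun p hp => hd p hp.2)
    hη.continuous hη'.continuous hηd hη.compact hη.support

/-! ### The very weak formulation and its limit -/

/-- A classical solution of the diffusion equation is a very weak solution. -/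
theorem IsClassicalSolution.very_weak {n : ℕ} {T k α : ℝ} {γ : ℝ → ℝ} {ε : ℝ}
    {φ₀ u₀ : Torus n → ℝ} {φ u η : Torus n × ℝ → ℝ}
    (h : IsClassicalSolution T k α γ ε φ₀ u₀ φ u) (hη : IsTest T η) :
    ∫ p, u p * (dt η p + ∑ i, dx i (dx i η) p - k * η p) ∂(cyl n T) =
      -∫ p, φ p * η p ∂(cyl n T) := by
  have hu := h.regular_u
  have cu := hu.continuousOn_Ioo
  have e1 := integral_cyl_dirDeriv_mul (continuous_timeDir n) cu hu.continuousOn_dt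
    (fun p hp => hu.hasDirDerivAt_time hp) hη hη.dt hη.hasDirDerivAt_time
  have e2 : ∀ i, ∫ p, dx i (dx i u) p * η p ∂(cyl n T) =
      ∫ p, u p * dx i (dx i η) p ∂(cyl n T) := fun i => by
    rw [integral_cyl_dirDeriv_mul (continuous_spaceDir i) (hu.continuousOn_dx i)
      (hu.continuousOn_dxx i i) (fun p hp => hu.hasDirDerivAt_dx i hp) hη (hη.dx i)
      (hη.hasDirDerivAt_space i), integral_cyl_dirDeriv_mul (continuous_spaceDir i) cu
      (hu.continuousOn_dx i) (fun p hp => hu.hasDirDerivAt_space i hp) (hη.dx i) ((hη.dx i).dx i)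
      ((hη.dx i).hasDirDerivAt_space i), neg_neg]
  have i1 := integrable_mul_test cu hη.dt
  have i2 := fun i => integrable_mul_test cu ((hη.dx i).dx i)
  have i3 := integrable_mul_test cu hη
  have j1 := integrable_mul_test hu.continuousOn_dt hη
  have j2 := fun i => integrable_mul_test (hu.continuousOn_dxx i i) hη
  have j3 := integrable_mul_test h.regular_φ.continuousOn_Ioo hη
  have key : ∫ p, dt u p * η p ∂(cyl n T) = ∫ p, (∑ i, dx i (dx i u) p * η p)
      - k * (u p * η p) + φ p * η p ∂(cyl n T) := by
    rw [cyl_eq_restrict]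
    refine setIntegral_congr_fun (measurableSet_cylinder n T) fun p hp => ?_
    have := h.eq_u p.1 p.2 hp.2
    simp only [Prod.mk.eta] at this
    simp only [this, laplacian, ← Finset.sum_mul]
    ring
  have s1 : Integrable (fun p => ∑ i, dx i (dx i u) p * η p) (cyl n T) :=
    integrable_finsetSum _ fun i _ => j2 i
  have s2 : Integrable (fun p => ∑ i, u p * dx i (dx i η) p) (cyl n T) :=
    integrable_finsetSum _ fun i _ => i2 i
  have s3 : Integrable (fun p => (∑ i, dx i (dx i u) p * η p) - k * (u p * η p)) (cyl n T) :=
    s1.sub (i3.const_mul k)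
  have s4 : Integrable (fun p => u p * dt η p + ∑ i, u p * dx i (dx i η) p) (cyl n T) :=
    i1.add s2
  rw [integral_add s3 j3, integral_sub s1 (i3.const_mul k),
    integral_finsetSum _ fun i _ => j2 i] at key
  simp only [e2] at key
  rw [← integral_finsetSum _ fun i _ => i2 i] at key
  have : ∀ p, u p * (dt η p + ∑ i, dx i (dx i η) p - k * η p) =
      u p * dt η p + (∑ i, u p * dx i (dx i η) p) - k * (u p * η p) := fun p => by
    rw [← Finset.mul_sum]; ring
  simp only [this]
  rw [integral_sub s4 (i3.const_mul k), integral_add i1 s2]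
  linarith

/-- Passage to the limit in the very weak formulation. -/
theorem weak_equation_of_limit {n : ℕ} {T k : ℝ} {v ψ : ℕ → Torus n × ℝ → ℝ}
    {u φ : Torus n × ℝ → ℝ} {g : Fin n → Torus n × ℝ → ℝ} {h : Torus n × ℝ → ℝ}
    (hu : IsH1Cyl T u g h) (hv : WeakL2Tendsto (cyl n T) v u)
    (hψc : ∀ j, ContinuousOn (ψ j) (univ ×ˢ Ioo 0 T)) (hφ : Integrable φ (cyl n T))
    (hψ : Tendsto (fun j => eLpNorm (fun p => ψ j p - φ p) 1 (cyl n T)) atTop (𝓝 0))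
    (heq : ∀ j, ∀ η, IsTest T η →
      ∫ p, v j p * (dt η p + ∑ i, dx i (dx i η) p - k * η p) ∂(cyl n T) =
        -∫ p, ψ j p * η p ∂(cyl n T)) {η : Torus n × ℝ → ℝ} (hη : IsTest T η) :
    ∫ p, h p * η p ∂(cyl n T) =
      ∫ p, (-(∑ i, g i p * dx i η p) - k * u p * η p + φ p * η p) ∂(cyl n T) := by
  have L : ∀ {f ζ : Torus n × ℝ → ℝ}, MemLp f 2 (cyl n T) → IsTest T ζ →
      Integrable (fun p => f p * ζ p) (cyl n T) := fun hf hζ => hf.integrable_mul (hζ.memLp 2)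
  have hz : MemLp (fun p => dt η p + ∑ i, dx i (dx i η) p - k * η p) 2 (cyl n T) :=
    ((hη.dt.memLp 2).add (memLp_finsetSum _ fun i _ => ((hη.dx i).dx i).memLp 2)).sub
      ((hη.memLp 2).const_mul k)
  obtain ⟨C, hC⟩ := hη.continuous.bounded_above_of_compact_support hη.compact
  have iφ : Integrable (fun p => φ p * η p) (cyl n T) :=
    hφ.mul_bdd (c := C) hη.continuous.aestronglyMeasurable (ae_of_all _ hC)
  have lim1 := hv.2.2 _ hz
  -- `L¹` convergence suffices here because `η` is bounded.
  have lim2 : Tendsto (fun j => ∫ p, ψ j p * η p ∂(cyl n T)) atTop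
      (𝓝 (∫ p, φ p * η p ∂(cyl n T))) := by
    refine tendsto_integral_of_L1 _ iφ.1 (Eventually.of_forall fun j => integrable_mul_test (hψc j) hη) ?_
    have hb : ∀ j, ∫⁻ p, ‖ψ j p * η p - φ p * η p‖ₑ ∂(cyl n T) ≤
        ENNReal.ofReal C * eLpNorm (fun p => ψ j p - φ p) 1 (cyl n T) := fun j => by
      rw [eLpNorm_one_eq_lintegral_enorm, ← lintegral_const_mul' _ _ ENNReal.ofReal_ne_top]
      refine lintegral_mono fun p => ?_
      rw [← sub_mul, enorm_mul, mul_comm]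
      gcongr
      rw [← ofReal_norm]
      exact ENNReal.ofReal_le_ofReal (hC p)
    refine tendsto_of_tendsto_of_tendsto_of_le_of_le tendsto_const_nhds ?_ (fun _ => zero_le) hb
    simpa using ENNReal.Tendsto.const_mul hψ (Or.inr ENNReal.ofReal_ne_top)
  have E := tendsto_nhds_unique lim1 (by simpa only [heq _ η hη] using lim2.neg)
  have : ∀ p, u p * (dt η p + ∑ i, dx i (dx i η) p - k * η p) =
      u p * dt η p + (∑ i, u p * dx i (dx i η) p) - k * (u p * η p) := fun p => by
    rw [← Finset.mul_sum]; ring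
  simp only [this] at E
  have i1 := L hu.memLp hη.dt
  have i2 := fun i => L hu.memLp ((hη.dx i).dx i)
  have i3 := L hu.memLp hη
  have i4 := fun i => L (hu.memLp_grad i) (hη.dx i)
  have s1 : Integrable (fun p => -∑ i, g i p * dx i η p) (cyl n T) :=
    (integrable_finsetSum _ fun i _ => i4 i).neg
  have s2 : Integrable (fun p => ∑ i, u p * dx i (dx i η) p) (cyl n T) :=
    integrable_finsetSum _ fun i _ => i2 i
  have s3 : Integrable (fun p => -(∑ i, g i p * dx i η p) - k * (u p * η p)) (cyl n T) :=
    s1.sub (i3.const_mul k)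
  have s4 : Integrable (fun p => u p * dt η p + ∑ i, u p * dx i (dx i η) p) (cyl n T) :=
    i1.add s2
  rw [integral_sub s4 (i3.const_mul k), integral_add i1 s2,
    integral_finsetSum _ fun i _ => i2 i, hu.weak_time η hη] at E
  -- `dx i η` is itself a test function, so exactly one of the two space derivatives goes back onto
  -- `u`.
  simp only [fun i => hu.weak_grad _ (hη.dx i) i] at E
  simp only [mul_assoc k]
  rw [integral_add s3 iφ, integral_sub s1 (i3.const_mul k), integral_neg,
    integral_finsetSum _ fun i _ => i4 i]
  rw [Finset.sum_neg_distrib] at E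
  linarith

/-! ### Moments of functions on the cylinder -/

/-- Smooth functions on the torus. -/
def IsSmoothTorus {n : ℕ} (a : Torus n → ℝ) : Prop :=
  ContDiff ℝ ∞ fun y : Fin n → ℝ => a (torusMk y)

theorem IsSmoothTorus.continuous {n : ℕ} {a : Torus n → ℝ} (ha : IsSmoothTorus a) : Continuous a :=
  (isOpenQuotientMap_torusMk n).isQuotientMap.continuous_iff.2 (ContDiff.continuous ha)

theorem IsSmoothTorus.isTest_mul {n : ℕ} {T : ℝ} {a : Torus n → ℝ} (ha : IsSmoothTorus a)
    {b : ℝ → ℝ}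
    (hb : ContDiff ℝ ∞ b) (hc : HasCompactSupport b) (hs : tsupport b ⊆ Ioo 0 T) :
    IsTest T fun p : Torus n × ℝ => a p.1 * b p.2 := by
  have h0 : Function.support (fun p : Torus n × ℝ => a p.1 * b p.2) ⊆ univ ×ˢ tsupport b :=
    fun p hp => ⟨mem_univ _, subset_tsupport _ (right_ne_zero_of_mul hp)⟩
  have hcl : IsClosed ((univ : Set (Torus n)) ×ˢ tsupport b) :=
    isClosed_univ.prod (isClosed_tsupport b)
  refine ⟨?_, ?_, (closure_minimal h0 hcl).trans (prod_mono_right hs)⟩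
  · exact (ContDiff.comp ha contDiff_fst).mul (hb.comp contDiff_snd)
  · exact HasCompactSupport.of_support_subset_isCompact (isCompact_univ.prod hc) h0

theorem continuousOn_moment {n : ℕ} {a : Torus n → ℝ} (ha : Continuous a) {f : Torus n × ℝ → ℝ}
    {S : Set ℝ} (hf : ContinuousOn f (univ ×ˢ S)) :
    ContinuousOn (fun t => ∫ x, f (x, t) * a x) S := by
  refine continuousOn_integral_of_compact_support (k := univ) isCompact_univ ?_ (by simp)
  have : ContinuousOn (fun z : ℝ × Torus n => f (z.2, z.1)) (S ×ˢ univ) :=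
    hf.comp continuous_swap.continuousOn fun z hz => ⟨mem_univ _, hz.1⟩
  exact this.mul (ha.comp continuous_snd).continuousOn

theorem continuous_slice {n : ℕ} {f : Torus n × ℝ → ℝ} {S : Set ℝ}
    (hf : ContinuousOn f (univ ×ˢ S)) {t : ℝ} (ht : t ∈ S) : Continuous fun x => f (x, t) :=
  continuousOn_univ.1 <| hf.comp (by fun_prop) fun _ _ => ⟨mem_univ _, ht⟩

/-- Differentiation under the integral: compactness of the torus times a small closed time interval
gives a constant dominating bound. -/
theorem IsClassical.hasDerivAt_moment {n : ℕ} {T : ℝ} {f : Torus n × ℝ → ℝ}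
    (hf : IsClassical T f) {a : Torus n → ℝ} (ha : Continuous a) {t : ℝ} (ht : t ∈ Ioo 0 T) :
    HasDerivAt (fun t => ∫ x, f (x, t) * a x) (∫ x, dt f (x, t) * a x) t := by
  obtain ⟨δ, hδ, hball⟩ := Metric.nhds_basis_closedBall.mem_iff.1 (isOpen_Ioo.mem_nhds ht)
  have hK : IsCompact ((univ : Set (Torus n)) ×ˢ Metric.closedBall t δ) :=
    isCompact_univ.prod (isCompact_closedBall t δ)
  have hcont : ContinuousOn (fun p : Torus n × ℝ => dt f p * a p.1)
      (univ ×ˢ Metric.closedBall t δ) :=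
    (hf.continuousOn_dt.mono (prod_mono_right hball)).mul (ha.comp continuous_fst).continuousOn
  obtain ⟨C, hC⟩ := hK.exists_bound_of_continuousOn hcont
  refine (hasDerivAt_integral_of_dominated_loc_of_deriv_le (bound := fun _ => C)
    (F' := fun t x => dt f (x, t) * a x) (s := Metric.closedBall t δ)
    (Metric.closedBall_mem_nhds t hδ) ?_ ?_ ?_ ?_ (integrable_const C) ?_).2
  · filter_upwards [Metric.closedBall_mem_nhds t hδ] with s hs
    exact ((continuous_slice hf.continuousOn_Ioo (hball hs)).mul ha).aestronglyMeasurable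
  · exact ((continuous_slice hf.continuousOn_Ioo ht).mul ha).integrable_of_hasCompactSupport
      (HasCompactSupport.of_compactSpace _)
  · exact ((continuous_slice hf.continuousOn_dt ht).mul ha).aestronglyMeasurable
  · exact ae_of_all _ fun x s hs => hC (x, s) ⟨mem_univ _, hs⟩
  · exact ae_of_all _ fun x s hs =>
      (hf.differentiable_time x s (hball hs)).hasDerivAt.mul_const (a x)

theorem integral_cyl_moment {n : ℕ} {T : ℝ} {f : Torus n × ℝ → ℝ} {a : Torus n → ℝ} {b : ℝ → ℝ}
    (hi : Integrable (fun p : Torus n × ℝ => f p * (a p.1 * b p.2)) (cyl n T)) :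
    ∫ p, f p * (a p.1 * b p.2) ∂(cyl n T) = ∫ t in Ioo 0 T, b t * ∫ x, f (x, t) * a x := by
  rw [cyl] at hi ⊢
  rw [integral_prod_symm _ hi]
  refine integral_congr_ae (ae_of_all _ fun t => ?_)
  simp only [← integral_const_mul]
  congr 1
  funext x
  ring

theorem integrable_cyl_mul_fst {n : ℕ} {T : ℝ} {f : Torus n × ℝ → ℝ} {a : Torus n → ℝ}
    (hf : Integrable f (cyl n T)) (ha : Continuous a) :
    Integrable (fun p : Torus n × ℝ => f p * a p.1) (cyl n T) := by
  obtain ⟨C, hC⟩ := isCompact_univ.exists_bound_of_continuousOn ha.continuousOn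
  exact hf.mul_bdd (c := C) (ha.comp continuous_fst).aestronglyMeasurable
    (ae_of_all _ fun p => hC p.1 (mem_univ _))

theorem integrable_moment {n : ℕ} {T : ℝ} {f : Torus n × ℝ → ℝ} {a : Torus n → ℝ}
    (hf : Integrable f (cyl n T)) (ha : Continuous a) :
    IntegrableOn (fun t => ∫ x, f (x, t) * a x) (Ioo 0 T) := by
  have := integrable_cyl_mul_fst hf ha
  rw [cyl] at this
  exact this.integral_prod_right

/-- The moments of a classical `H¹` function are absolutely continuous up to the initial time. -/
theorem IsClassical.moment_eq {n : ℕ} {T : ℝ} {f : Torus n × ℝ → ℝ}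
    {g : Fin n → Torus n × ℝ → ℝ} {h : Torus n × ℝ → ℝ} (hf : IsClassical T f)
    (hH : IsH1Cyl T f g h) {a : Torus n → ℝ} (ha : IsSmoothTorus a) {t : ℝ} (ht : t ∈ Ico 0 T) :
    ∫ x, f (x, t) * a x =
      (∫ x, f (x, 0) * a x) + ∫ s in (0 : ℝ)..t, ∫ x, h (x, s) * a x := by
  have hc := continuousOn_moment ha.continuous hf.continuousOn
  have hc' := continuousOn_moment ha.continuous hf.continuousOn_dt
  have hhi : Integrable h (cyl n T) := hH.memLp_time.integrable (by norm_num)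
  have hq := integrable_moment hhi ha.continuous
  -- The classical and weak time derivatives have the same moments: test with products `a(x) b(t)`
  -- and apply the fundamental lemma of the calculus of variations in `t`.
  have hae : ∀ᵐ s, s ∈ Ioo 0 T → (∫ x, dt f (x, s) * a x) - (∫ x, h (x, s) * a x) = 0 := by
    refine isOpen_Ioo.ae_eq_zero_of_integral_contDiff_smul_eq_zero
      ((hc'.locallyIntegrableOn measurableSet_Ioo).sub hq.locallyIntegrableOn) ?_
    intro b hb hbc hbs
    have hη := ha.isTest_mul hb hbc hbs
    have i1 := integrable_mul_test hf.continuousOn_dt hη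
    have i2 : Integrable (fun p => h p * (a p.1 * b p.2)) (cyl n T) :=
      hH.memLp_time.integrable_mul (hη.memLp 2)
    have e1 := integral_cyl_dirDeriv_mul (continuous_timeDir n) hf.continuousOn_Ioo
      hf.continuousOn_dt (fun p hp => hf.hasDirDerivAt_time hp) hη hη.dt hη.hasDirDerivAt_time
    rw [hH.weak_time _ hη, neg_neg, integral_cyl_moment i1, integral_cyl_moment i2] at e1
    have hout : ∀ s ∉ Ioo 0 T, b s = 0 := fun s hs =>
      image_eq_zero_of_notMem_tsupport fun hs' => hs (hbs hs')
    rw [← setIntegral_eq_integral_of_forall_compl_eq_zero (s := Ioo 0 T)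
      fun s hs => by rw [hout s hs, zero_smul]]
    obtain ⟨C, hC⟩ := hb.continuous.bounded_above_of_compact_support hbc
    have j2 : IntegrableOn (fun s => b s * ∫ x, h (x, s) * a x) (Ioo 0 T) :=
      hq.bdd_mul (c := C) hb.continuous.aestronglyMeasurable (ae_of_all _ hC)
    have j1 : IntegrableOn (fun s => b s * ∫ x, dt f (x, s) * a x) (Ioo 0 T) := by
      rw [cyl] at i1
      refine i1.integral_prod_right.congr (ae_of_all _ fun s => ?_)
      simp only [← integral_const_mul]
      congr 1
      funext x
      ring
    simp only [smul_eq_mul, mul_sub]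
    rw [integral_sub j1 j2, e1, sub_self]
  have hsub : Ioo 0 t ⊆ Ioo 0 T := Ioo_subset_Ioo_right ht.2.le
  have hae' : (fun s => ∫ x, h (x, s) * a x) =ᵐ[volume.restrict (Ioo 0 t)]
      fun s => ∫ x, dt f (x, s) * a x := by
    refine (ae_restrict_iff' measurableSet_Ioo).2 ?_
    filter_upwards [hae] with s hs hst
    exact (sub_eq_zero.1 (hs (hsub hst))).symm
  -- The classical derivative carries no bound as `t → 0`; integrability up to `0` is inherited from
  -- `h ∈ L²`.
  have hint : IntervalIntegrable (fun s => ∫ x, dt f (x, s) * a x) volume 0 t :=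
    (intervalIntegrable_iff_integrableOn_Ioo_of_le ht.1).2 ((hq.mono_set hsub).congr hae')
  have ftc := intervalIntegral.integral_eq_sub_of_hasDerivAt_of_le ht.1
    (hc.mono (Icc_subset_Ico_right ht.2))
    (fun s hs => hf.hasDerivAt_moment ha.continuous (hsub hs)) hint
  have : ∫ s in (0 : ℝ)..t, ∫ x, h (x, s) * a x = ∫ s in (0 : ℝ)..t, ∫ x, dt f (x, s) * a x := by
    rw [intervalIntegral.integral_of_le ht.1, intervalIntegral.integral_of_le ht.1,
      integral_Ioc_eq_integral_Ioo, integral_Ioc_eq_integral_Ioo]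
    exact integral_congr_ae hae'
  rw [this, ftc]
  ring

/-- Fatou's lemma applied to `|f j - G|` gives `∫ |F - G| = 0` directly, with no extraction of a
subsequence. -/
theorem ae_eq_of_tendsto_of_lintegral {X : Type*} [MeasurableSpace X] {μ : Measure X}
    {f : ℕ → X → ℝ} {F G : X → ℝ} (hm : ∀ j, AEStronglyMeasurable (f j) μ)
    (hG : AEStronglyMeasurable G μ) (hF : ∀ᵐ x ∂μ, Tendsto (fun j => f j x) atTop (𝓝 (F x)))
    (h : Tendsto (fun j => ∫⁻ x, ‖f j x - G x‖ₑ ∂μ) atTop (𝓝 0)) : F =ᵐ[μ] G := by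
  have hfatou := lintegral_liminf_le' (μ := μ) (u := atTop) (f := fun j x => ‖f j x - G x‖ₑ)
    fun j => ((hm j).sub hG).enorm
  have hlim : ∀ᵐ x ∂μ, liminf (fun j => ‖f j x - G x‖ₑ) atTop = ‖F x - G x‖ₑ := by
    filter_upwards [hF] with x hx using (hx.sub_const (G x)).enorm.liminf_eq
  have hFm : AEStronglyMeasurable F μ := aestronglyMeasurable_of_tendsto_ae atTop hm hF
  rw [h.liminf_eq, nonpos_iff_eq_zero, lintegral_congr_ae hlim,
    lintegral_eq_zero_iff' (f := fun x => ‖F x - G x‖ₑ) (hFm.sub hG).enorm] at hfatou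
  filter_upwards [hfatou] with x hx
  simpa [sub_eq_zero] using hx

/-! ### Time primitives of `L²` functions on the cylinder -/

section Primitive

variable {n : ℕ} {T : ℝ} {h : Torus n × ℝ → ℝ}

theorem cyl_restrict (n : ℕ) {T : ℝ} {I : Set ℝ} (hI : I ⊆ Ioo 0 T) :
    (volume : Measure (Torus n)).prod (volume.restrict I) = (cyl n T).restrict (univ ×ˢ I) := by
  rw [cyl, ← Measure.prod_restrict, Measure.restrict_univ, Measure.restrict_restrict_of_subset hI]

theorem cyl_prod_le (n : ℕ) {T : ℝ} {I : Set ℝ} (hI : I ⊆ Ioo 0 T) :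
    (volume : Measure (Torus n)).prod (volume.restrict I) ≤ cyl n T := by
  rw [cyl_restrict n hI]; exact Measure.restrict_le_self

theorem uIoc_subset_Ioo {T t₁ t₂ : ℝ} (h₁ : t₁ ∈ Ico 0 T) (h₂ : t₂ ∈ Ico 0 T) :
    Set.uIoc t₁ t₂ ⊆ Ioo 0 T := fun _ hs =>
  ⟨(le_min h₁.1 h₂.1).trans_lt hs.1, hs.2.trans_lt (max_lt h₁.2 h₂.2)⟩

theorem aestronglyMeasurable_intervalIntegral (hh : AEStronglyMeasurable h (cyl n T)) {t₁ t₂ : ℝ}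
    (h₁ : t₁ ∈ Ico 0 T) (h₂ : t₂ ∈ Ico 0 T) :
    AEStronglyMeasurable (fun x => ∫ s in t₁..t₂, h (x, s)) volume := by
  simp only [intervalIntegral.intervalIntegral_eq_integral_uIoc]
  have := (hh.mono_measure (cyl_prod_le n (uIoc_subset_Ioo h₁ h₂))).integral_prod_right'
  exact this.const_smul (if t₁ ≤ t₂ then (1 : ℝ) else -1)

/-- Cauchy–Schwarz in time for almost every `x`, then Tonelli in `x`. The power `1/2` is what makes
primitives continuous in time with values in `L²`. -/
theorem eLpNorm_intervalIntegral_le (hh : AEStronglyMeasurable h (cyl n T)) {t₁ t₂ : ℝ}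
    (h₁ : t₁ ∈ Ico 0 T) (h₂ : t₂ ∈ Ico 0 T) :
    eLpNorm (fun x => ∫ s in t₁..t₂, h (x, s)) 2 volume ≤
      ENNReal.ofReal |t₂ - t₁| ^ (1 / 2 : ℝ) * eLpNorm h 2 (cyl n T) := by
  have hI := uIoc_subset_Ioo h₁ h₂
  set I := Set.uIoc t₁ t₂
  have hvol : volume I = ENNReal.ofReal |t₂ - t₁| := by
    simp only [I, Set.uIoc, Real.volume_Ioc, max_sub_min_eq_abs]
  have hm := hh.mono_measure (cyl_prod_le n hI)
  have hpt : ∀ᵐ x : Torus n, ‖∫ s in t₁..t₂, h (x, s)‖ₑ ^ (2 : ℝ) ≤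
      volume I * ∫⁻ s in I, ‖h (x, s)‖ₑ ^ (2 : ℝ) := by
    filter_upwards [hm.prodMk_left] with x hx
    have e1 : ‖∫ s in t₁..t₂, h (x, s)‖ₑ ≤ eLpNorm (fun s => h (x, s)) 1 (volume.restrict I) := by
      rw [eLpNorm_one_eq_lintegral_enorm, ← ofReal_norm,
        intervalIntegral.norm_intervalIntegral_eq, ofReal_norm]
      exact enorm_integral_le_lintegral_enorm _
    have e2 := e1.trans (eLpNorm_le_eLpNorm_mul_rpow_measure_univ (p := 1) (q := 2) (by norm_num) hx)
    have e3 := ENNReal.rpow_le_rpow e2 (zero_le_two (α := ℝ))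
    refine e3.trans_eq ?_
    rw [ENNReal.mul_rpow_of_nonneg _ _ zero_le_two, ← ENNReal.rpow_mul, Measure.restrict_apply_univ,
      eLpNorm_eq_lintegral_rpow_enorm_toReal (by norm_num) (by norm_num), ← ENNReal.rpow_mul, mul_comm]
    norm_num
  rw [eLpNorm_eq_lintegral_rpow_enorm_toReal (by norm_num) (by norm_num),
    eLpNorm_eq_lintegral_rpow_enorm_toReal (by norm_num) (by norm_num)]
  simp only [ENNReal.toReal_ofNat]
  rw [← ENNReal.mul_rpow_of_nonneg _ _ (by norm_num)]
  refine ENNReal.rpow_le_rpow ?_ (by norm_num)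
  refine (lintegral_mono_ae hpt).trans ?_
  rw [lintegral_const_mul' _ _ (by rw [hvol]; exact ENNReal.ofReal_ne_top), hvol]
  gcongr
  rw [← lintegral_prod _ (hm.enorm.pow_const _)]
  exact lintegral_mono' (cyl_prod_le n hI) le_rfl

theorem memLp_intervalIntegral (hh : MemLp h 2 (cyl n T)) {t₁ t₂ : ℝ}
    (h₁ : t₁ ∈ Ico 0 T) (h₂ : t₂ ∈ Ico 0 T) :
    MemLp (fun x => ∫ s in t₁..t₂, h (x, s)) 2 volume :=
  ⟨aestronglyMeasurable_intervalIntegral hh.1 h₁ h₂,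
    (eLpNorm_intervalIntegral_le hh.1 h₁ h₂).trans_lt
      (ENNReal.mul_lt_top (ENNReal.rpow_lt_top_of_nonneg (by norm_num) ENNReal.ofReal_ne_top) hh.2)⟩

/-- The variable upper limit becomes the indicator of `{s ≤ t}` on triples `(x, t, s)`, and
integrating out `s` keeps joint measurability. -/
theorem aestronglyMeasurable_primitive (hh : AEStronglyMeasurable h (cyl n T)) :
    AEStronglyMeasurable (fun p : Torus n × ℝ => ∫ s in (0 : ℝ)..p.2, h (p.1, s)) (cyl n T) := by
  have hq : Measure.QuasiMeasurePreserving (fun z : (Torus n × ℝ) × ℝ => (z.1.1, z.2))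
      ((cyl n T).prod (volume.restrict (Ioo 0 T))) (cyl n T) := by
    refine ⟨by fun_prop, ?_⟩
    change Measure.map (Prod.map Prod.fst id) _ ≪ _
    rw [← Measure.map_prod_map _ _ measurable_fst measurable_id, Measure.map_id]
    exact Measure.quasiMeasurePreserving_fst.absolutelyContinuous.prod .rfl
  have hS : MeasurableSet {z : (Torus n × ℝ) × ℝ | z.2 ≤ z.1.2} :=
    measurableSet_le measurable_snd (measurable_snd.comp measurable_fst)
  have hm := ((hh.comp_quasiMeasurePreserving hq).indicator hS).integral_prod_right'
  refine hm.congr ?_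
  rw [cyl_eq_restrict]
  refine (ae_restrict_iff' (measurableSet_cylinder n T)).2 (ae_of_all _ fun p hp => ?_)
  have : (fun s => {z : (Torus n × ℝ) × ℝ | z.2 ≤ z.1.2}.indicator
      (h ∘ fun z : (Torus n × ℝ) × ℝ => (z.1.1, z.2)) (p, s)) =
      (Iic p.2).indicator fun s => h (p.1, s) := by
    funext s
    by_cases hs : s ≤ p.2 <;> simp [indicator, hs]
  have hI : Ioo 0 T ∩ Iic p.2 = Ioc 0 p.2 := by
    ext s
    exact ⟨fun hs => ⟨hs.1.1, hs.2⟩, fun hs => ⟨⟨hs.1, hs.2.trans_lt hp.2.2⟩, hs.2⟩⟩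
  beta_reduce
  rw [this, setIntegral_indicator measurableSet_Iic, hI, intervalIntegral.integral_of_le hp.2.1.le]

theorem integral_primitive_mul (hh : Integrable h (cyl n T)) {a : Torus n → ℝ} (ha : Continuous a)
    {t : ℝ} (ht : t ∈ Ico 0 T) :
    ∫ x, (∫ s in (0 : ℝ)..t, h (x, s)) * a x = ∫ s in (0 : ℝ)..t, ∫ x, h (x, s) * a x := by
  have hI : Ioc 0 t ⊆ Ioo 0 T := fun s hs => ⟨hs.1, hs.2.trans_lt ht.2⟩
  have hi := (integrable_cyl_mul_fst hh ha).mono_measure (cyl_prod_le n hI)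
  simp only [intervalIntegral.integral_of_le ht.1, ← integral_mul_const]
  exact integral_integral_swap (f := fun x s => h (x, s) * a x) hi

/-- This writes the time-integrated moment as a pairing with a fixed `L²` function, so that weak
convergence of the time derivatives can be applied at each fixed `t`. -/
theorem integral_cyl_indicator (hh : Integrable h (cyl n T)) {a : Torus n → ℝ} (ha : Continuous a)
    {t : ℝ} (ht : t ∈ Ico 0 T) :
    ∫ p, h p * (a p.1 * (Ioc 0 t).indicator (fun _ => 1) p.2) ∂(cyl n T) =
      ∫ s in (0 : ℝ)..t, ∫ x, h (x, s) * a x := by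
  have hI : Ioc 0 t ⊆ Ioo 0 T := fun s hs => ⟨hs.1, hs.2.trans_lt ht.2⟩
  have hi : Integrable (fun p : Torus n × ℝ =>
      h p * (a p.1 * (Ioc 0 t).indicator (fun _ => 1) p.2)) (cyl n T) := by
    refine ((integrable_cyl_mul_fst hh ha).indicator
      (MeasurableSet.univ.prod (measurableSet_Ioc (a := (0 : ℝ)) (b := t)))).congr
      (ae_of_all _ fun p => ?_)
    beta_reduce
    by_cases hp : p.2 ∈ Ioc 0 t
    · rw [indicator_of_mem (show p ∈ univ ×ˢ Ioc 0 t from ⟨mem_univ _, hp⟩), indicator_of_mem hp,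
        mul_one]
    · rw [indicator_of_notMem (fun h => hp h.2), indicator_of_notMem hp, mul_zero, mul_zero]
  rw [integral_cyl_moment hi, intervalIntegral.integral_of_le ht.1]
  have : ∀ s, (Ioc 0 t).indicator (fun _ => (1 : ℝ)) s * ∫ x, h (x, s) * a x =
      (Ioc 0 t).indicator (fun s => ∫ x, h (x, s) * a x) s := fun s => by
    by_cases hs : s ∈ Ioc 0 t <;> simp [hs]
  simp only [this]
  rw [setIntegral_indicator measurableSet_Ioc, inter_eq_right.2 hI]

theorem memLp_cyl_indicator {a : Torus n → ℝ} (ha : Continuous a) (t : ℝ) :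
    MemLp (fun p : Torus n × ℝ => a p.1 * (Ioc 0 t).indicator (fun _ => (1 : ℝ)) p.2) 2
      (cyl n T) := by
  obtain ⟨C, hC⟩ := isCompact_univ.exists_bound_of_continuousOn ha.continuousOn
  have hm : Measurable ((Ioc 0 t).indicator (fun _ => (1 : ℝ))) :=
    measurable_const.indicator measurableSet_Ioc
  refine MemLp.of_bound ((ha.comp continuous_fst).aestronglyMeasurable.mul
    (hm.comp measurable_snd).aestronglyMeasurable) C (ae_of_all _ fun p => ?_)
  have h0 := hC p.1 (mem_univ _)
  by_cases hp : p.2 ∈ Ioc 0 t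
  · simpa [hp] using h0
  · simpa [hp] using (norm_nonneg _).trans h0

end Primitive

/-! ### Identification of the limit and its initial value -/

/-- Strong convergence in `L²` of the cylinder implies convergence of moments in `L¹(0,T)`. -/
theorem tendsto_lintegral_moment {n : ℕ} {T : ℝ} {v : ℕ → Torus n × ℝ → ℝ} {u : Torus n × ℝ → ℝ}
    (hv : ∀ j, MemLp (v j) 2 (cyl n T)) (hu : MemLp u 2 (cyl n T))
    (hlim : Tendsto (fun j => eLpNorm (fun p => v j p - u p) 2 (cyl n T)) atTop (𝓝 0))
    {a : Torus n → ℝ} (ha : Continuous a) :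
    Tendsto (fun j => ∫⁻ t in Ioo 0 T, ‖(∫ x, v j (x, t) * a x) - ∫ x, u (x, t) * a x‖ₑ) atTop
      (𝓝 0) := by
  obtain ⟨C, hC⟩ := isCompact_univ.exists_bound_of_continuousOn ha.continuousOn
  have hi : ∀ {f : Torus n × ℝ → ℝ}, MemLp f 2 (cyl n T) → Integrable f (cyl n T) :=
    fun hf => hf.integrable (by norm_num)
  have hsl : ∀ {f : Torus n × ℝ → ℝ}, MemLp f 2 (cyl n T) →
      ∀ᵐ t ∂(volume.restrict (Ioo 0 T)), Integrable fun x => f (x, t) * a x := fun hf => by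
    have := integrable_cyl_mul_fst (hi hf) ha
    rw [cyl] at this
    exact this.prod_left_ae
  -- A bound for `|a|` times the Hölder constant of `L² ⊆ L¹` on the finite-measure cylinder.
  set c : ENNReal := ENNReal.ofReal C * cyl n T univ ^ (1 / (1 : ENNReal).toReal - 1 / (2 : ENNReal).toReal)
    with hc
  have hctop : c ≠ ⊤ := ENNReal.mul_ne_top ENNReal.ofReal_ne_top
    (ENNReal.rpow_ne_top_of_nonneg (by norm_num) (measure_ne_top _ _))
  have hb : ∀ j, ∫⁻ t in Ioo 0 T, ‖(∫ x, v j (x, t) * a x) - ∫ x, u (x, t) * a x‖ₑ ≤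
      c * eLpNorm (fun p => v j p - u p) 2 (cyl n T) := fun j => by
    have hw : MemLp (fun p => v j p - u p) 2 (cyl n T) := (hv j).sub hu
    calc ∫⁻ t in Ioo 0 T, ‖(∫ x, v j (x, t) * a x) - ∫ x, u (x, t) * a x‖ₑ
        ≤ ∫⁻ t in Ioo 0 T, ∫⁻ x, ‖(v j (x, t) - u (x, t)) * a x‖ₑ := by
          refine lintegral_mono_ae ?_
          filter_upwards [hsl (hv j), hsl hu] with t h1 h2
          rw [← integral_sub h1 h2]
          simp only [← sub_mul]
          exact enorm_integral_le_lintegral_enorm _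
      _ = ∫⁻ p, ‖(v j p - u p) * a p.1‖ₑ ∂(cyl n T) := by
          have := (integrable_cyl_mul_fst (hi hw) ha).1.enorm
          rw [cyl] at this ⊢
          exact (lintegral_prod_symm _ this).symm
      _ ≤ ∫⁻ p, ENNReal.ofReal C * ‖v j p - u p‖ₑ ∂(cyl n T) := by
          refine lintegral_mono fun p => ?_
          rw [enorm_mul, mul_comm]
          gcongr
          rw [← ofReal_norm]
          exact ENNReal.ofReal_le_ofReal (hC p.1 (mem_univ _))
      _ = ENNReal.ofReal C * eLpNorm (fun p => v j p - u p) 1 (cyl n T) := by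
          rw [eLpNorm_one_eq_lintegral_enorm, lintegral_const_mul' _ _ ENNReal.ofReal_ne_top]
      _ ≤ c * eLpNorm (fun p => v j p - u p) 2 (cyl n T) := by
          rw [hc, mul_assoc, mul_comm (_ ^ _)]
          gcongr
          exact eLpNorm_le_eLpNorm_mul_rpow_measure_univ (by norm_num) hw.1
  refine tendsto_of_tendsto_of_tendsto_of_le_of_le tendsto_const_nhds ?_ (fun _ => zero_le) hb
  simpa using ENNReal.Tendsto.const_mul hlim (Or.inr hctop)

theorem isSmoothTorus_mFourier {n : ℕ} (k : Fin n → ℤ) (L : ℂ →L[ℝ] ℝ) :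
    IsSmoothTorus fun x : Torus n => L (UnitAddTorus.mFourier k x) := by
  refine L.contDiff.comp ?_
  simp only [UnitAddTorus.mFourier, torusMk, ContinuousMap.coe_mk, fourier_coe_apply]
  refine contDiff_prod fun i _ => ?_
  refine ContDiff.cexp (((contDiff_const.mul ?_)).div_const _)
  exact Complex.ofRealCLM.contDiff.comp (contDiff_apply ℝ ℝ i)

/-- `L²` functions on the torus with the same real Fourier coefficients agree. -/
theorem ae_eq_of_integral_mul_eq {n : ℕ} {w₁ w₂ : Torus n → ℝ} (h₁ : MemLp w₁ 2) (h₂ : MemLp w₂ 2)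
    (hre : ∀ k : Fin n → ℤ, ∫ x, w₁ x * (UnitAddTorus.mFourier k x).re =
      ∫ x, w₂ x * (UnitAddTorus.mFourier k x).re)
    (him : ∀ k : Fin n → ℤ, ∫ x, w₁ x * (UnitAddTorus.mFourier k x).im =
      ∫ x, w₂ x * (UnitAddTorus.mFourier k x).im) : w₁ =ᵐ[volume] w₂ := by
  have hint : ∀ {w : Torus n → ℝ}, MemLp w 2 → ∀ (k : Fin n → ℤ) (L : ℂ →L[ℝ] ℝ),
      Integrable fun x => w x * L (UnitAddTorus.mFourier k x) := fun hw k L =>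
    hw.integrable_mul (q := 2) ((isSmoothTorus_mFourier k L).continuous.memLp_of_hasCompactSupport
      (HasCompactSupport.of_compactSpace _))
  have hw : MemLp (fun x => w₁ x - w₂ x) 2 := h₁.sub h₂
  have := ae_eq_zero_of_integral_mFourier hw fun k => by
    have r1 := hint h₁ k Complex.reCLM
    have r2 := hint h₂ k Complex.reCLM
    have m1 := hint h₁ k Complex.imCLM
    have m2 := hint h₂ k Complex.imCLM
    simp only [Complex.reCLM_apply, Complex.imCLM_apply] at r1 r2 m1 m2
    have hr : ∫ x, (w₁ x - w₂ x) * (UnitAddTorus.mFourier k x).re = 0 := by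
      simp only [sub_mul]; rw [integral_sub r1 r2, hre k, sub_self]
    have hm : ∫ x, (w₁ x - w₂ x) * (UnitAddTorus.mFourier k x).im = 0 := by
      simp only [sub_mul]; rw [integral_sub m1 m2, him k, sub_self]
    have hR : Integrable fun x => (((w₁ x - w₂ x) * (UnitAddTorus.mFourier k x).re : ℝ) : ℂ) := by
      have : Integrable fun x => (w₁ x - w₂ x) * (UnitAddTorus.mFourier k x).re := by
        simp only [sub_mul]
        exact r1.sub r2
      exact this.ofReal
    have hM : Integrable fun x => (((w₁ x - w₂ x) * (UnitAddTorus.mFourier k x).im : ℝ) : ℂ) := by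
      have : Integrable fun x => (w₁ x - w₂ x) * (UnitAddTorus.mFourier k x).im := by
        simp only [sub_mul]
        exact m1.sub m2
      exact this.ofReal
    have e : ∀ x, UnitAddTorus.mFourier k x * ((w₁ x - w₂ x : ℝ) : ℂ) =
        (((w₁ x - w₂ x) * (UnitAddTorus.mFourier k x).re : ℝ) : ℂ) +
        (((w₁ x - w₂ x) * (UnitAddTorus.mFourier k x).im : ℝ) : ℂ) * Complex.I := fun x => by
      apply Complex.ext <;> simp [mul_comm]
    simp only [e]
    rw [integral_add hR (hM.mul_const _), integral_mul_const, integral_complex_ofReal,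
      integral_complex_ofReal, hr, hm]
    simp
  filter_upwards [this] with x hx
  simpa [sub_eq_zero] using hx

/-- The limit of classical solutions attains the weak limit of the initial data. -/
theorem hasInitialValue_of_limit {n : ℕ} {T : ℝ} (hT : 0 < T) {v : ℕ → Torus n × ℝ → ℝ}
    {gv : ℕ → Fin n → Torus n × ℝ → ℝ} {hv : ℕ → Torus n × ℝ → ℝ} {u h : Torus n × ℝ → ℝ}
    {u₀ : Torus n → ℝ} (hcl : ∀ j, IsClassical T (v j)) (hH : ∀ j, IsH1Cyl T (v j) (gv j) (hv j))
    (hu : MemLp u 2 (cyl n T))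
    (hlim : Tendsto (fun j => eLpNorm (fun p => v j p - u p) 2 (cyl n T)) atTop (𝓝 0))
    (hh : WeakL2Tendsto (cyl n T) hv h)
    (h₀ : WeakL2Tendsto volume (fun j x => v j (x, 0)) u₀) : HasInitialValue T u u₀ := by
  have h0T : (0 : ℝ) ∈ Ico 0 T := ⟨le_rfl, hT⟩
  have hint : ∀ {f : Torus n × ℝ → ℝ}, MemLp f 2 (cyl n T) → Integrable f (cyl n T) :=
    fun hf => hf.integrable (by norm_num)
  have hh2 := hh.2.1
  have hslice : ∀ t ∈ Ico 0 T, MemLp (fun x => u₀ x + ∫ s in (0 : ℝ)..t, h (x, s)) 2 :=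
    fun t ht => h₀.2.1.add (memLp_intervalIntegral hh2 h0T ht)
  have hmem : ∀ {a : Torus n → ℝ}, Continuous a → MemLp a 2 := fun ha =>
    ha.memLp_of_hasCompactSupport (HasCompactSupport.of_compactSpace _)
  -- The exceptional set of times depends on `a`, so only countably many `a` may be used
  -- simultaneously later.
  have hmom : ∀ a : Torus n → ℝ, IsSmoothTorus a → ∀ᵐ t ∂(volume.restrict (Ioo 0 T)),
      ∫ x, u (x, t) * a x = ∫ x, (u₀ x + ∫ s in (0 : ℝ)..t, h (x, s)) * a x := by
    intro a ha
    have hpt : ∀ᵐ t ∂(volume.restrict (Ioo 0 T)), Tendsto (fun j => ∫ x, v j (x, t) * a x) atTop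
        (𝓝 (∫ x, (u₀ x + ∫ s in (0 : ℝ)..t, h (x, s)) * a x)) := by
      refine (ae_restrict_iff' measurableSet_Ioo).2 (ae_of_all _ fun t ht => ?_)
      have ht' : t ∈ Ico 0 T := Ioo_subset_Ico_self ht
      have l1 := h₀.2.2 a (hmem ha.continuous)
      have l2 := hh.2.2 _ (memLp_cyl_indicator (T := T) ha.continuous t)
      rw [integral_cyl_indicator (hint hh2) ha.continuous ht'] at l2
      simp only [fun j => integral_cyl_indicator (hint (hh.1 j)) ha.continuous ht'] at l2
      simp only [fun j => (hcl j).moment_eq (hH j) ha ht', add_mul]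
      have i1 : Integrable fun x => u₀ x * a x := h₀.2.1.integrable_mul (hmem ha.continuous)
      have i2 : Integrable fun x => (∫ s in (0 : ℝ)..t, h (x, s)) * a x :=
        (memLp_intervalIntegral hh2 h0T ht').integrable_mul (hmem ha.continuous)
      rw [integral_add i1 i2, integral_primitive_mul (hint hh2) ha.continuous ht']
      exact l1.add l2
    have := ae_eq_of_tendsto_of_lintegral
      (fun j => (integrable_moment (hint (hH j).memLp) ha.continuous).1)
      (integrable_moment (hint hu) ha.continuous).1 hpt
      (tendsto_lintegral_moment (fun j => (hH j).memLp) hu hlim ha.continuous)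
    filter_upwards [this] with t ht using ht.symm
  have husl : ∀ᵐ t ∂(volume.restrict (Ioo 0 T)), MemLp (fun x => u (x, t)) 2 := by
    have hm := hu.1
    have hsq := hu.integrable_sq
    rw [cyl] at hm hsq
    filter_upwards [hm.prod_swap.prodMk_left, hsq.prod_left_ae] with t h1 h2
    exact (memLp_two_iff_integrable_sq h1).2 h2
  refine ⟨fun p => u₀ p.1 + ∫ s in (0 : ℝ)..p.2, h (p.1, s), ?_, hslice, ?_, by simp⟩
  · have hm : AEStronglyMeasurable (fun p : Torus n × ℝ => u₀ p.1 + ∫ s in (0 : ℝ)..p.2, h (p.1, s))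
        (cyl n T) :=
      (h₀.2.1.1.comp_quasiMeasurePreserving Measure.quasiMeasurePreserving_fst).add
        (aestronglyMeasurable_primitive hh2.1)
    -- Characters are indexed by the countable set `Fin n → ℤ`, so one null set of times serves them
    -- all.
    have hae : ∀ᵐ t ∂(volume.restrict (Ioo 0 T)), ∀ᵐ x : Torus n,
        u₀ x + ∫ s in (0 : ℝ)..t, h (x, s) = u (x, t) := by
      have h1 := ae_all_iff.2 fun k : Fin n → ℤ => hmom _ (isSmoothTorus_mFourier k Complex.reCLM)
      have h2 := ae_all_iff.2 fun k : Fin n → ℤ => hmom _ (isSmoothTorus_mFourier k Complex.imCLM)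
      filter_upwards [h1, h2, husl, ae_restrict_mem measurableSet_Ioo] with t k1 k2 k3 ht
      exact ae_eq_of_integral_mul_eq (hslice t (Ioo_subset_Ico_self ht)) k3
        (fun k => (k1 k).symm) (fun k => (k2 k).symm)
    have hd : AEMeasurable (fun p : Torus n × ℝ =>
        ‖(u₀ p.1 + ∫ s in (0 : ℝ)..p.2, h (p.1, s)) - u p‖ₑ) (cyl n T) := (hm.sub hu.1).enorm
    have hd' := hd
    rw [cyl] at hd'
    -- Tonelli turns equality on almost every time slice into equality almost everywhere on the
    -- cylinder; this needs the joint measurability `hm`.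
    have hz : ∫⁻ p, ‖(u₀ p.1 + ∫ s in (0 : ℝ)..p.2, h (p.1, s)) - u p‖ₑ ∂(cyl n T) = 0 := by
      rw [cyl, lintegral_prod_symm _ hd']
      refine (lintegral_congr_ae (g := fun _ => 0) ?_).trans lintegral_zero
      filter_upwards [hae] with t ht
      refine (lintegral_congr_ae (g := fun _ => 0) ?_).trans lintegral_zero
      filter_upwards [ht] with x hx
      simp [hx]
    rw [lintegral_eq_zero_iff' hd] at hz
    filter_upwards [hz] with p hp
    simpa [sub_eq_zero] using hp
  · intro s hs
    have hb : ∀ t ∈ Ico 0 T, eLpNorm (fun x : Torus n => (u₀ x + ∫ r in (0 : ℝ)..t, h (x, r)) -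
        (u₀ x + ∫ r in (0 : ℝ)..s, h (x, r))) 2 volume ≤
        ENNReal.ofReal |t - s| ^ (1 / 2 : ℝ) * eLpNorm h 2 (cyl n T) := by
      intro t ht
      refine le_trans (le_of_eq ?_) (eLpNorm_intervalIntegral_le hh2.1 hs ht)
      refine eLpNorm_congr_ae ?_
      have hi := hint hh2
      rw [cyl] at hi
      filter_upwards [hi.prod_right_ae] with x hx
      have hii : ∀ r ∈ Ico 0 T, IntervalIntegrable (fun r => h (x, r)) volume 0 r := fun r hr =>
        intervalIntegrable_iff.2 (IntegrableOn.mono_set hx (uIoc_subset_Ioo h0T hr))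
      rw [add_sub_add_left_eq_sub, intervalIntegral.integral_interval_sub_left (hii t ht) (hii s hs)]
    refine tendsto_of_tendsto_of_tendsto_of_le_of_le' tendsto_const_nhds ?_
      (Eventually.of_forall fun _ => zero_le) (eventually_mem_nhdsWithin.mono hb)
    have hc : Continuous fun t : ℝ => ENNReal.ofReal |t - s| ^ (1 / 2 : ℝ) :=
      ENNReal.continuous_rpow_const.comp (ENNReal.continuous_ofReal.comp (by fun_prop))
    have hc0 : Tendsto (fun t : ℝ => ENNReal.ofReal |t - s| ^ (1 / 2 : ℝ)) (𝓝[Ico 0 T] s) (𝓝 0) :=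
      (hc.tendsto' s 0 (by simp)).mono_left nhdsWithin_le_nhds
    simpa using ENNReal.Tendsto.mul_const hc0 (Or.inr hh2.2.ne)

end PhaseField

theorem mainTheorem5 (n : ℕ) (hn : n = 2 ∨ n = 3) (T k α : ℝ) (hT : 0 < T)
    (γ : ℝ → ℝ) (hγ_smooth : ContDiffOn ℝ 2 γ (Ioi 0)) (hγ_anti : AntitoneOn γ (Ioi 0))
    (hγ_bdd : BddAbove (γ '' Ici 0))
    -- the family of classical solutions, indexed by `ε > 0`, and its initial data
    (φε uε : ℝ → Torus n × ℝ → ℝ) (φ₀ε u₀ε : ℝ → Torus n → ℝ)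
    (hsol : ∀ ε, 0 < ε → IsClassicalSolution T k α γ ε (φ₀ε ε) (u₀ε ε) (φε ε) (uε ε))
    (hφ₀ : ∀ ε, 0 < ε → ∀ x, 0 < φ₀ε ε x ∧ φ₀ε ε x < 1)
    (hu₀ : ∀ ε, 0 < ε → ∀ x, 0 ≤ u₀ε ε x)
    (hu₀_bdd : ∃ C : ℝ, ∀ ε, 0 < ε → ∃ g : Fin n → Torus n → ℝ, IsH1Torus (u₀ε ε) g ∧
      (∫ x, u₀ε ε x ^ 2) + ∫ x, ∑ i, g i x ^ 2 ≤ C)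
    (hφ₀_bdd : ∃ C : ℝ, ∀ ε, 0 < ε → ∃ g : Fin n → Torus n → ℝ, IsH1Torus (φ₀ε ε) g ∧
      ∫ x, (ε * (∑ i, g i x ^ 2) / 2 + W (φ₀ε ε x) / (2 * ε)) ≤ C)
    -- the sequence `ε_j ↘ 0` and the limit pairs
    (e : ℕ → ℝ) (he_pos : ∀ j, 0 < e j) (he_lim : Tendsto e atTop (𝓝 0))
    (u φ : Torus n × ℝ → ℝ)
    (hu : IsLimitPairU T (fun j => uε (e j)) u)
    (hφ : IsLimitPairφ T (fun j => φε (e j)) φ)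
    -- weak convergence of the initial data along a subsequence
    (u₀ : Torus n → ℝ) (σ : ℕ → ℕ) (hσ : StrictMono σ)
    (hu₀_lim : WeakL2Tendsto volume (fun j => u₀ε (e (σ j))) u₀) :
    IsWeakSolution T k φ u₀ u := by
  obtain ⟨gv, hv, g, h, hH, hHu, hwu, -, hwh⟩ := hu.weakH1
  refine ⟨⟨g, h, hHu, fun η hη => ?_⟩, ?_⟩
  · exact weak_equation_of_limit (ψ := fun j => φε (e j)) hHu hwu
      (fun j => (hsol _ (he_pos j)).regular_φ.continuousOn_Ioo) hφ.bv.1 hφ.strongL1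
      (fun j ζ hζ => (hsol _ (he_pos j)).very_weak hζ) hη
  · have hinit : (fun j x => uε (e (σ j)) (x, 0)) = fun j => u₀ε (e (σ j)) :=
      funext fun j => funext (hsol _ (he_pos (σ j))).init_u
    -- The initial data converge only along `σ`; the other convergences pass to this subsequence
    -- with the same limits `u` and `h`.
    refine hasInitialValue_of_limit (v := fun j => uε (e (σ j))) (gv := fun j => gv (σ j))
      (hv := fun j => hv (σ j)) (h := h) hT (fun j => (hsol _ (he_pos (σ j))).regular_u)
      (fun j => hH (σ j)) hHu.memLp (hu.strongL2.comp hσ.tendsto_atTop) ?_ ?_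
    · exact ⟨fun j => hwh.1 (σ j), hwh.2.1, fun z hz => (hwh.2.2 z hz).comp hσ.tendsto_atTop⟩
    · rw [hinit]
      exact hu₀_lim
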